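/- A coarse structure on a set $X$ is a family $\mathcal{E}$ of subsets of $X\times X$ that contains the diagonal $\triangle_X$ and is closed under composition, inversion, finite unions and passing to subsets. For $E\in\mathcal{E}$, $x\in X$, $A\subseteq X$ write $E[x]=\{y : (x,y)\in E\}$ and $E[A]=\bigcup_{a\in A}E[a]$. A family $\mathcal{M}$ of subsets of $X$ is $E$-bounded if every $A\in\mathcal{M}$ is contained in $E[x]$ for some $x\in X$, and $E$-disjoint if $E[A]\cap B=\emptyset$ for all distinct $A,B\in\mathcal{M}$. One writes $\operatorname{asdim}(X,\mathcal{E})\le n$ if for each $E\in\mathcal{E}$ there are $F\in\mathcal{E}$ and an $F$-bounded covering $\mathcal{M}$ of $X$ that can be partitioned as $\mathcal{M}=\mathcal{M}_0\cup\dots\cup\mathcal{M}_n$ with each $\mathcal{M}_i$ $E$-disjoint; $\operatorname{asdim}(X,\mathcal{E})$ is the least such $n$, and $\infty$ if there is none. For a Hausdorff topological group $G$ let $\mathcal{C}$ be the family of precompact subsets of $G$, i.e. those whose closure in $G$ is compact, and let $(G,\mathcal{C})$ be $G$ with the coarse structure whose base is $\{\{(x,y) : x\in Ay\}\cup\triangle_G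 : A\in\mathcal{C}\}$. **Theorem 3.** For every non-discrete countable metrizable abelian topological group $G$, $\operatorname{asdim}(G,\mathcal{C})=\infty$. In particular, $\operatorname{asdim}(G,\mathcal{C})=\infty$ for every infinite cyclic subgroup $G$ of the circle group, with the subspace topology. -/

import Mathlib

open scoped Pointwise

/-- A coarse structure on a set `X`, given by its family of entourages. -/
structure CoarseStructure (X : Type*) where
  /-- The entourages. -/
  entourages : Set (Set (X × X))
  diag_mem : {p : X × X | p.1 = p.2} ∈ entourages
  comp_mem : ∀ E ∈ entourages, ∀ E' ∈ entourages,
    {p : X × X | ∃ z, (p.1, z) ∈ E ∧ (z, p.2) ∈ E'} ∈ entourages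
  inv_mem : ∀ E ∈ entourages, {p : X × X | (p.2, p.1) ∈ E} ∈ entourages
  union_mem : ∀ E ∈ entourages, ∀ E' ∈ entourages, E ∪ E' ∈ entourages
  subset_mem : ∀ E ∈ entourages, ∀ H, H ⊆ E → H ∈ entourages

namespace CoarseStructure

/-- The ball `E[x]` of radius `E` around the point `x`. -/
def ball {X : Type*} (E : Set (X × X)) (x : X) : Set X := {y | (x, y) ∈ E}

/-- The ball `E[A]` of radius `E` around the set `A`. -/
def setBall {X : Type*} (E : Set (X × X)) (A : Set X) : Set X := ⋃ a ∈ A, ball E a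

/-- A family of subsets is `E`-bounded if each member lies in a ball of radius `E`. -/
def BoundedFamily {X : Type*} (E : Set (X × X)) (M : Set (Set X)) : Prop :=
  ∀ A ∈ M, ∃ x, A ⊆ ball E x

/-- A family of subsets is `E`-disjoint if `E[A] ∩ B = ∅` for all distinct members `A`, `B`. -/
def DisjointFamily {X : Type*} (E : Set (X × X)) (M : Set (Set X)) : Prop :=
  ∀ A ∈ M, ∀ B ∈ M, A ≠ B → setBall E A ∩ B = ∅

/-- `asdim (X, 𝓔) ≤ n`: for each entourage `E` there are an entourage `F` and an `F`-bounded
covering of `X` that can be partitioned into `n + 1` families, each of them `E`-disjoint. -/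
def AsdimLE {X : Type*} (𝓔 : CoarseStructure X) (n : ℕ) : Prop :=
  ∀ E ∈ 𝓔.entourages, ∃ F ∈ 𝓔.entourages, ∃ M : Set (Set X),
    BoundedFamily F M ∧ ⋃₀ M = Set.univ ∧
      ∃ P : Fin (n + 1) → Set (Set X),
        M = ⋃ i, P i ∧ (∀ i j, i ≠ j → Disjoint (P i) (P j)) ∧ ∀ i, DisjointFamily E (P i)

/-- The asymptotic dimension: the least `n` with `asdim (X, 𝓔) ≤ n`, and `⊤` (that is, `∞`)
if there is no such `n`. -/
noncomputable def asdim {X : Type*} (𝓔 : CoarseStructure X) : ℕ∞ :=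
  sInf {d : ℕ∞ | ∃ n : ℕ, d = n ∧ AsdimLE 𝓔 n}

end CoarseStructure

/-- A group ideal: a family of subsets of `G` that contains all finite subsets and is closed
under taking subsets and under `(A, B) ↦ A * B⁻¹`. -/
structure GroupIdeal (G : Type*) [Group G] where
  /-- The members of the ideal. -/
  sets : Set (Set G)
  finite_mem : ∀ A : Set G, A.Finite → A ∈ sets
  mul_inv_mem : ∀ A ∈ sets, ∀ B ∈ sets, A * B⁻¹ ∈ sets
  subset_mem : ∀ A ∈ sets, ∀ C, C ⊆ A → C ∈ sets

namespace GroupIdeal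

variable {G : Type*} [Group G]

theorem inv_mem (I : GroupIdeal G) {A : Set G} (hA : A ∈ I.sets) : A⁻¹ ∈ I.sets := by
  have h := I.mul_inv_mem {1} (I.finite_mem _ (Set.finite_singleton 1)) A hA
  simpa using h

theorem mul_mem (I : GroupIdeal G) {A B : Set G} (hA : A ∈ I.sets) (hB : B ∈ I.sets) :
    A * B ∈ I.sets := by
  simpa using I.mul_inv_mem A hA B⁻¹ (I.inv_mem hB)

theorem union_mem (I : GroupIdeal G) {A B : Set G} (hA : A ∈ I.sets) (hB : B ∈ I.sets) :
    A ∪ B ∈ I.sets := by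
  rcases A.eq_empty_or_nonempty with rfl | ⟨a, ha⟩
  · simpa using hB
  rcases B.eq_empty_or_nonempty with rfl | ⟨b, hb⟩
  · simpa using hA
  refine I.subset_mem _
    (I.mul_mem (I.mul_mem hA (I.finite_mem ({a⁻¹} : Set G) (by simp)))
      (I.mul_mem hB (I.finite_mem ({b⁻¹ * a, 1} : Set G) (by simp)))) _ ?_
  rintro x (hx | hx)
  · exact ⟨x * a⁻¹, ⟨x, hx, a⁻¹, rfl, rfl⟩, b * (b⁻¹ * a), ⟨b, hb, b⁻¹ * a, by simp, rfl⟩,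
      by simp⟩
  · exact ⟨a * a⁻¹, ⟨a, ha, a⁻¹, rfl, rfl⟩, x * 1, ⟨x, hx, 1, by simp, rfl⟩, by simp⟩

/-- The basic entourage `{(x, y) : x ∈ A y} ∪ Δ` of a subset `A` of a group. -/
def basicEntourage (A : Set G) : Set (G × G) :=
  {p | p.1 ∈ A * {p.2}} ∪ {p | p.1 = p.2}

theorem mem_basicEntourage {A : Set G} {x y : G} :
    (x, y) ∈ basicEntourage A ↔ x * y⁻¹ ∈ A ∪ {1} := by
  simp [basicEntourage, mul_inv_eq_one, or_comm]

/-- The coarse structure of a group ideal, with the base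
`{(x, y) : x ∈ A y} ∪ Δ`, where `A` runs over the ideal. -/
def coarseStructure (I : GroupIdeal G) : CoarseStructure G where
  entourages := {E | ∃ A ∈ I.sets, E ⊆ basicEntourage A}
  diag_mem := ⟨∅, I.finite_mem _ Set.finite_empty, fun _ h => Or.inr h⟩
  comp_mem := by
    rintro E ⟨A, hA, hE⟩ E' ⟨B, hB, hE'⟩
    have h1 : ({1} : Set G) ∈ I.sets := I.finite_mem _ (Set.finite_singleton 1)
    refine ⟨(A ∪ {1}) * (B ∪ {1}), I.mul_mem (I.union_mem hA h1) (I.union_mem hB h1), ?_⟩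
    rintro ⟨x, y⟩ ⟨z, hxz, hzy⟩
    refine mem_basicEntourage.2 (Or.inl ?_)
    exact ⟨x * z⁻¹, mem_basicEntourage.1 (hE hxz), z * y⁻¹, mem_basicEntourage.1 (hE' hzy),
      by simp⟩
  inv_mem := by
    rintro E ⟨A, hA, hE⟩
    refine ⟨A⁻¹, I.inv_mem hA, ?_⟩
    rintro ⟨x, y⟩ hxy
    have h := mem_basicEntourage.1 (hE hxy)
    rw [mem_basicEntourage]
    rcases h with h | h
    · left
      simpa using h
    · right
      have h' : y * x⁻¹ = 1 := h
      have : x * y⁻¹ = 1 := by rw [← inv_inj]; simpa using h'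
      exact this
  union_mem := by
    rintro E ⟨A, hA, hE⟩ E' ⟨B, hB, hE'⟩
    refine ⟨A ∪ B, I.union_mem hA hB, ?_⟩
    rintro ⟨x, y⟩ (h | h)
    · rcases mem_basicEntourage.1 (hE h) with h | h
      exacts [mem_basicEntourage.2 (Or.inl (Or.inl h)), mem_basicEntourage.2 (Or.inr h)]
    · rcases mem_basicEntourage.1 (hE' h) with h | h
      exacts [mem_basicEntourage.2 (Or.inl (Or.inr h)), mem_basicEntourage.2 (Or.inr h)]
  subset_mem := by
    rintro E ⟨A, hA, hE⟩ H hH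
    exact ⟨A, hA, hH.trans hE⟩

end GroupIdeal

/-- The group ideal of all precompact subsets of a Hausdorff topological group, that is, of
all subsets whose closure is compact. -/
def precompactIdeal (G : Type*) [Group G] [TopologicalSpace G] [IsTopologicalGroup G]
    [T2Space G] : GroupIdeal G where
  sets := {A | IsCompact (closure A)}
  finite_mem := fun _ hA => hA.isCompact.closure
  mul_inv_mem := fun _ hA _ hB =>
    (IsCompact.mul hA (IsCompact.inv hB)).closure_of_subset
      (Set.mul_subset_mul subset_closure (Set.inv_subset_inv.2 subset_closure))
  subset_mem := fun _ hA _ hC =>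
    IsCompact.of_isClosed_subset hA isClosed_closure (closure_mono hC)

/-! Suppose the dimension is at most `n`. The contradiction comes from maps of (n+1)-dimensional
grids into `G` that move adjacent points by a bounded amount while keeping opposite faces far apart.

Since `G` is countable and non-discrete, a diagonal construction gives a sequence `a` tending to 1,
with small tail products, whose partial products cluster nowhere
(`exists_seq_small_tails_no_cluster`). Hence products of `a` over suitable blocks of indices leave
any given compact set, whatever happens at the other indices (`exists_block_avoiding`). Take n+1
disjoint blocks and send `z` to the product over the `i`-th block truncated at `z i`, for all `i`.
Adjacent points then differ by an element of a compact set that does not depend on the blocks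
(`exists_compact_forall_adjacent`), so it can be fixed before the cover, and the blocks can be
chosen after the cover's bound.

Colour a grid point by the index of a family covering its image, and label it by the covering
member. Disjointness makes adjacent points of equal colour share a label. By
`exists_cells_joining_faces`, one member meets the images of two opposite faces in the direction of
its colour, against its boundedness. -/

/-! ### Cubical Sperner lemma and Lebesgue covering theorem, through cup products modulo 2. -/

section Grid

variable {ι : Type*} [DecidableEq ι]

/-- The value at the grid cell with lowest vertex `z` spanned by the directions in `S` of the cup
product modulo 2 of the coboundaries of the functions in a list: the sum over all monotone edge
paths through the cell of the products of the increments of the functions along the edges. -/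
def cupSum : List ((ι → ℕ) → ZMod 2) → Finset ι → (ι → ℕ) → ZMod 2
  | [], S, _ => if S = ∅ then 1 else 0
  | f :: L, S, z =>
    ∑ j ∈ S, (f (z + Pi.single j 1) + f z) * cupSum L (S.erase j) (z + Pi.single j 1)

/-- Leibniz rule: if `ω` is closed, then `δf ∪ ω = δ(f ω)`. -/
theorem cupSum_cons_eq_of_closed (f : (ι → ℕ) → ZMod 2) (L : List ((ι → ℕ) → ZMod 2))
    (S : Finset ι) (z : ι → ℕ)
    (h : ∑ j ∈ S, (cupSum L (S.erase j) (z + Pi.single j 1) + cupSum L (S.erase j) z) = 0) :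
    cupSum (f :: L) S z = ∑ j ∈ S, (f (z + Pi.single j 1) *
      cupSum L (S.erase j) (z + Pi.single j 1) + f z * cupSum L (S.erase j) z) := by
  have h2 : (2 : ZMod 2) = 0 := rfl
  have h3 : ∑ j ∈ S, f z * (cupSum L (S.erase j) (z + Pi.single j 1)
      + cupSum L (S.erase j) z) = 0 := by rw [← Finset.mul_sum, h, mul_zero]
  rw [cupSum, ← sub_eq_zero, ← Finset.sum_sub_distrib, ← h3]
  refine Finset.sum_congr rfl fun j _ => ?_
  linear_combination (-f z * cupSum L (S.erase j) z) * h2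

theorem sum_sum_erase_eq_zero (S : Finset ι) (c : ι → ι → ZMod 2) (hc : ∀ j k, c j k = c k j) :
    ∑ j ∈ S, ∑ k ∈ S.erase j, c j k = 0 := by
  rw [Finset.sum_sigma']
  refine Finset.sum_involution (fun p _ => ⟨p.2, p.1⟩) ?_ ?_ ?_ ?_
  · rintro ⟨j, k⟩ _
    simp only
    rw [hc k j]
    exact CharTwo.add_self_eq_zero _
  · rintro ⟨j, k⟩ hp _ h
    simp only [Finset.mem_sigma, Finset.mem_erase] at hp
    have : k = j := congrArg Sigma.fst h
    exact hp.2.1 this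
  · rintro ⟨j, k⟩ hp
    simp only [Finset.mem_sigma, Finset.mem_erase] at hp ⊢
    exact ⟨hp.2.2, fun h => hp.2.1 h.symm, hp.1⟩
  · rintro ⟨j, k⟩ _
    rfl

/-- The cup product of coboundaries is a cocycle. -/
theorem cupSum_closed (L : List ((ι → ℕ) → ZMod 2)) (S : Finset ι) (z : ι → ℕ) :
    ∑ j ∈ S, (cupSum L (S.erase j) (z + Pi.single j 1) + cupSum L (S.erase j) z) = 0 := by
  induction L generalizing S z with
  | nil =>
    refine Finset.sum_eq_zero fun j _ => ?_
    simp only [cupSum]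
    exact CharTwo.add_self_eq_zero _
  | cons f L ih =>
    simp only [cupSum_cons_eq_of_closed f L _ _ (ih _ _), ← Finset.sum_add_distrib]
    -- This is `δδ = 0`: the summand is symmetric in the two directions, so the terms cancel in
    -- pairs modulo 2.
    refine sum_sum_erase_eq_zero S _ fun j k => ?_
    simp only [Finset.erase_right_comm (a := j) (b := k), add_right_comm z (Pi.single j 1)]
    ring

theorem cupSum_cons (f : (ι → ℕ) → ZMod 2) (L : List ((ι → ℕ) → ZMod 2))
    (S : Finset ι) (z : ι → ℕ) :
    cupSum (f :: L) S z = ∑ j ∈ S, (f (z + Pi.single j 1) *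
      cupSum L (S.erase j) (z + Pi.single j 1) + f z * cupSum L (S.erase j) z) :=
  cupSum_cons_eq_of_closed f L S z (cupSum_closed L S z)

/-- Each path product contains an increment of `f` along an edge of the cell, and that increment is
zero. -/
theorem cupSum_eq_zero {L : List ((ι → ℕ) → ZMod 2)} {f : (ι → ℕ) → ZMod 2} (hf : f ∈ L)
    {S : Finset ι} {z : ι → ℕ}
    (h : ∀ v, z ≤ v → (∀ i, v i ≤ z i + 1) → (∀ i ∉ S, v i = z i) → f v = f z) :
    cupSum L S z = 0 := by
  induction L generalizing S z with
  | nil => simp at hf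
  | cons g L ih =>
    rw [cupSum]
    refine Finset.sum_eq_zero fun j hj => ?_
    have hz : f (z + Pi.single j 1) = f z := by
      refine h _ le_self_add (fun i => ?_) fun i hi => ?_
      · rcases eq_or_ne i j with rfl | hij
        · simp
        · simp [hij]
      · have hij : i ≠ j := fun e => hi (e ▸ hj)
        simp [hij]
    rcases List.mem_cons.1 hf with rfl | hf
    · rw [hz, CharTwo.add_self_eq_zero, zero_mul]
    · rw [ih hf, mul_zero]
      intro v hv hv1 hv2
      rw [hz]
      refine h v (le_self_add.trans hv) (fun i => ?_) fun i hi => ?_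
      · rcases eq_or_ne i j with rfl | hij
        · simpa using (hv2 i (by simp)).le
        · simpa [hij] using hv1 i
      · have hij : i ≠ j := fun e => hi (e ▸ hj)
        simpa [hij] using hv2 i (by simp [hi])

variable [Fintype ι]

theorem sum_piFinset_update_insert {M : Type*} [AddCommMonoid M] (s : ι → Finset ℕ) (j : ι)
    {a : ℕ} {t : Finset ℕ} (ha : a ∉ t) (b : (ι → ℕ) → M) :
    ∑ z ∈ Fintype.piFinset (Function.update s j (insert a t)), b z =
      ∑ z ∈ Fintype.piFinset (Function.update s j t), b z +
        ∑ z ∈ Fintype.piFinset (Function.update s j {a}), b z := by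
  rw [← Finset.sum_union]
  · refine Finset.sum_congr ?_ fun _ _ => rfl
    ext z
    simp only [Fintype.mem_piFinset, Finset.mem_union]
    constructor
    · intro h
      have hj := h j
      simp only [Function.update_self, Finset.mem_insert] at hj
      rcases hj with hj | hj
      · refine Or.inr fun i => ?_
        rcases eq_or_ne i j with rfl | hij
        · simpa using hj
        · simpa [hij] using h i
      · refine Or.inl fun i => ?_
        rcases eq_or_ne i j with rfl | hij
        · simpa using hj
        · simpa [hij] using h i
    · rintro (h | h) i
      · have := h i
        rcases eq_or_ne i j with rfl | hij
        · simp_all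
        · simpa [hij] using this
      · have := h i
        rcases eq_or_ne i j with rfl | hij
        · simp_all
        · simpa [hij] using this
  · rw [Finset.disjoint_left]
    intro z h1 h2
    have h1 := Fintype.mem_piFinset.1 h1 j
    have h2 := Fintype.mem_piFinset.1 h2 j
    simp only [Function.update_self, Finset.mem_singleton] at h1 h2
    exact ha (h2 ▸ h1)

theorem sum_piFinset_update_singleton_shift {M : Type*} [AddCommMonoid M] (s : ι → Finset ℕ)
    (j : ι) (a : ℕ) (b : (ι → ℕ) → M) :
    ∑ z ∈ Fintype.piFinset (Function.update s j {a}), b (z + Pi.single j 1) =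
      ∑ z ∈ Fintype.piFinset (Function.update s j {a + 1}), b z := by
  refine Finset.sum_bij' (fun z _ => z + Pi.single j 1) (fun z _ => z - Pi.single j 1)
    ?_ ?_ ?_ ?_ ?_
  · intro z hz
    rw [Fintype.mem_piFinset] at hz ⊢
    intro i
    have := hz i
    rcases eq_or_ne i j with rfl | hij
    · simp_all
    · simpa [hij] using this
  · intro z hz
    rw [Fintype.mem_piFinset] at hz ⊢
    intro i
    have := hz i
    rcases eq_or_ne i j with rfl | hij
    · simp_all
    · simpa [hij] using this
  · intro z _
    simp
  · intro z hz
    have hj := Fintype.mem_piFinset.1 hz j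
    simp only [Function.update_self, Finset.mem_singleton] at hj
    ext i
    rcases eq_or_ne i j with rfl | hij
    · simp [hj]
    · simp [hij]
  · intro z _
    rfl

theorem sum_piFinset_update_range (s : ι → Finset ℕ) (j : ι) (m : ℕ) (b : (ι → ℕ) → ZMod 2) :
    ∑ z ∈ Fintype.piFinset (Function.update s j (Finset.range m)),
        (b (z + Pi.single j 1) + b z) =
      ∑ z ∈ Fintype.piFinset (Function.update s j {m}), b z +
        ∑ z ∈ Fintype.piFinset (Function.update s j {0}), b z := by
  induction m with
  | zero =>
    rw [CharTwo.add_self_eq_zero]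
    refine Finset.sum_eq_zero fun z hz => ?_
    simpa using Fintype.mem_piFinset.1 hz j
  | succ m ih =>
    rw [Finset.range_add_one, sum_piFinset_update_insert s j Finset.notMem_range_self, ih,
      Finset.sum_add_distrib, sum_piFinset_update_singleton_shift]
    have h2 : (2 : ZMod 2) = 0 := rfl
    linear_combination (∑ z ∈ Fintype.piFinset (Function.update s j {m}), b z) * h2

/-- Stokes' formula, by induction on dimension. The integrand is `δ(h i · ω)`, so only boundary
faces count. On faces in a direction `j ≠ i`, `h j` is constant and `ω` vanishes; on the face at 0
in direction `i`, `h i` is zero; on the opposite one `h i` is 1, which leaves the sum for `J`. -/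
theorem sum_cupSum_eq_one {m : ℕ} {h : ι → (ι → ℕ) → ZMod 2} (h0 : ∀ i v, v i = 0 → h i v = 0)
    (h1 : ∀ i v, v i = m → h i v = 1) (J : List ι) (hJ : J.Nodup) :
    ∑ z ∈ Fintype.piFinset (fun i => if i ∈ J.toFinset then Finset.range m else {m}),
      cupSum (J.map h) J.toFinset z = 1 := by
  induction J with
  | nil => simp [cupSum, Fintype.piFinset_singleton]
  | cons i J ih =>
    obtain ⟨hi, hJ⟩ := List.nodup_cons.1 hJ
    set S := (i :: J).toFinset with hS
    simp only [List.map_cons, cupSum_cons]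
    rw [Finset.sum_comm]
    set s : ι → ι → Finset ℕ := fun j k => if k ∈ S.erase j then Finset.range m else {m} with hs
    have hbox : ∀ j ∈ S, (fun k => if k ∈ S then Finset.range m else {m}) =
        Function.update (s j) j (Finset.range m) := by
      intro j hj
      funext k
      rcases eq_or_ne k j with rfl | hkj
      · simp [hj]
      · simp [hkj, hs]
    have hstep : ∀ j ∈ S, ∑ z ∈ Fintype.piFinset (fun k => if k ∈ S then Finset.range m else {m}),
        (h i (z + Pi.single j 1) * cupSum (J.map h) (S.erase j) (z + Pi.single j 1) +
          h i z * cupSum (J.map h) (S.erase j) z) =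
        ∑ z ∈ Fintype.piFinset (Function.update (s j) j {m}),
          h i z * cupSum (J.map h) (S.erase j) z +
        ∑ z ∈ Fintype.piFinset (Function.update (s j) j {0}),
          h i z * cupSum (J.map h) (S.erase j) z := by
      intro j hj
      rw [hbox j hj]
      exact sum_piFinset_update_range (s j) j m
        (fun z => h i z * cupSum (J.map h) (S.erase j) z)
    rw [Finset.sum_congr rfl hstep, Finset.sum_eq_single_of_mem i (by simp [hS])]
    · have hSi : S.erase i = J.toFinset := by simp [hS, hi]
      rw [Finset.sum_eq_zero (s := Fintype.piFinset (Function.update (s i) i {0})), add_zero]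
      · rw [← ih hJ, hSi]
        refine Finset.sum_congr ?_ fun z hz => ?_
        · congr 1
          funext k
          rcases eq_or_ne k i with rfl | hki
          · simp [hi]
          · simp [hki, hs, hS]
        · have hz := Fintype.mem_piFinset.1 hz i
          rw [h1 i z (by simpa [hi] using hz), one_mul]
      · intro z hz
        have hz := Fintype.mem_piFinset.1 hz i
        rw [h0 i z (by simpa using hz), zero_mul]
    · intro j hj hji
      have hjJ : h j ∈ J.map h := by
        refine List.mem_map_of_mem ?_
        simpa [hS, hji] using hj
      rw [Finset.sum_eq_zero, Finset.sum_eq_zero, add_zero]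
      · intro z hz
        have hz : z j = 0 := by simpa using Fintype.mem_piFinset.1 hz j
        rw [cupSum_eq_zero hjJ, mul_zero]
        intro v _ _ hv
        rw [h0 j z hz, h0 j v (by rw [hv j (by simp), hz])]
      · intro z hz
        have hz : z j = m := by simpa using Fintype.mem_piFinset.1 hz j
        rw [cupSum_eq_zero hjJ, mul_zero]
        intro v _ _ hv
        rw [h1 j z hz, h1 j v (by rw [hv j (by simp), hz])]

/-- Kuhn's cubical Sperner lemma. -/
theorem exists_cell_forall_ne {m : ℕ} {h : ι → (ι → ℕ) → ZMod 2}
    (h0 : ∀ i v, v i = 0 → h i v = 0) (h1 : ∀ i v, v i = m → h i v = 1) :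
    ∃ z : ι → ℕ, (∀ i, z i < m) ∧ ∀ i, ∃ v, z ≤ v ∧ (∀ k, v k ≤ z k + 1) ∧ h i v ≠ h i z := by
  have hsum := sum_cupSum_eq_one h0 h1 Finset.univ.toList (Finset.nodup_toList _)
  obtain ⟨z, hz, hne⟩ := Finset.exists_ne_zero_of_sum_ne_zero (hsum.trans_ne one_ne_zero)
  refine ⟨z, fun i => by simpa using Fintype.mem_piFinset.1 hz i, fun i => ?_⟩
  by_contra! hcon
  refine hne (cupSum_eq_zero (f := h i) (by simp) fun v hv hv1 _ => hcon v hv hv1)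

/-- A discrete form of Lebesgue's covering theorem: if the cells of a cubical grid are coloured
by the directions, and adjacent cells of the same colour carry the same label, then some label
joins two opposite faces in the direction of its colour. -/
theorem exists_cells_joining_faces {α : Type*} {m : ℕ} (hm : 0 < m) (c : (ι → ℕ) → ι)
    (K : (ι → ℕ) → α)
    (hK : ∀ z z' : ι → ℕ, (∀ i, z i ≤ z' i + 1 ∧ z' i ≤ z i + 1) → c z = c z' → K z = K z') :
    ∃ i, ∃ z z' : ι → ℕ, c z = i ∧ c z' = i ∧ K z = K z' ∧ z i = 0 ∧ z' i + 1 = m := by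
  classical
  by_contra! hcon
  -- `Q i` selects the cells of colour `i` whose label reaches the face at 0 in direction `i`; `R i`
  -- marks their vertices and that face. If no label joins the faces, `R i` misses the face at `m`.
  set Q : ι → (ι → ℕ) → Prop := fun i z => c z = i ∧ ∃ z' : ι → ℕ, c z' = i ∧ K z' = K z ∧ z' i = 0
    with hQ
  set R : ι → (ι → ℕ) → Prop := fun i v => v i = 0 ∨ ∃ z, (∀ k, z k < m) ∧ z ≤ v ∧
    (∀ k, v k ≤ z k + 1) ∧ Q i z with hR
  obtain ⟨z, hz, hne⟩ := exists_cell_forall_ne (m := m)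
    (h := fun i v => if R i v then 0 else 1) (fun i v hv => if_pos (Or.inl hv)) (by
      intro i v hv
      refine if_neg ?_
      rintro (h | ⟨z, hz, hzv, hvz, hc, z', hc', hKz, hz'⟩)
      · omega
      · refine hcon i z' z hc' hc hKz hz' ?_
        have := hz i
        have := hvz i
        omega)
  obtain ⟨v, hzv, hvz, hne⟩ := hne (c z)
  -- Cells sharing a vertex with `z` are adjacent to it, so those of its colour carry its label.
  -- Hence the function for direction `c z` is constant on the cell `z`.
  have key : ∀ v, z ≤ v → (∀ k, v k ≤ z k + 1) → (R (c z) v ↔ Q (c z) z) := by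
    intro v hzv hvz
    constructor
    · rintro (h | ⟨y, _, hyv, hvy, hc, y', hc', hKy, hy'⟩)
      · exact ⟨rfl, z, rfl, rfl, Nat.le_zero.1 (h ▸ hzv (c z))⟩
      · refine ⟨rfl, y', hc', hKy.trans (hK y z (fun i => ?_) hc), hy'⟩
        exact ⟨(hyv i).trans (hvz i), (hzv i).trans (hvy i)⟩
    · intro h
      exact Or.inr ⟨z, hz, hzv, hvz, h⟩
  refine hne ?_
  simp only [key v hzv hvz, key z le_rfl (fun k => Nat.le_succ _)]

end Grid

/-! ### A null sequence with escaping partial products. -/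

section Sequence

open Filter Topology

variable {G : Type*} [CommGroup G]

theorem prod_mem_mul_self_of_tail {v : ℕ → Set G} {a : ℕ → G} (h1 : ∀ k, 1 ∈ v k)
    (hv : ∀ k, v (k + 1) * v (k + 1) ⊆ v k) (ha : ∀ k, a k ∈ v k) {N : ℕ} {U : Finset ℕ}
    (hU : ∀ k ∈ U, N ≤ k) : ∏ k ∈ U, a k ∈ v N * v N := by
  have key : ∀ n N (U : Finset ℕ), (∀ k ∈ U, N ≤ k ∧ k < N + n) →
      ∏ k ∈ U, a k ∈ v N * v N := by
    intro n
    induction n with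
    | zero =>
      intro N U hU
      have : U = ∅ := Finset.eq_empty_of_forall_notMem fun k hk => by
        have := hU k hk
        omega
      subst this
      exact ⟨1, h1 N, 1, h1 N, by simp⟩
    | succ n ih =>
      intro N U hU
      have hmem : ∏ k ∈ U.erase N, a k ∈ v N := by
        refine hv N (ih (N + 1) _ fun k hk => ?_)
        obtain ⟨hkN, hk⟩ := Finset.mem_erase.1 hk
        have := hU k hk
        omega
      by_cases hN : N ∈ U
      · rw [← Finset.mul_prod_erase U a hN]
        exact Set.mul_mem_mul (ha N) hmem
      · rw [Finset.erase_eq_of_notMem hN] at hmem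
        exact ⟨1, h1 N, _, hmem, one_mul _⟩
  refine key (U.sup id + 1) N U fun k hk => ⟨hU k hk, ?_⟩
  have : k ≤ U.sup id := Finset.le_sup (f := id) hk
  omega

variable [TopologicalSpace G] [IsTopologicalGroup G]

theorem exists_mem_ne_of_not_discrete (hG : ¬ DiscreteTopology G) {v : Set G} (hv : v ∈ 𝓝 (1 : G))
    (g : G) : ∃ a ∈ v, a ≠ g := by
  by_contra! h
  refine hG (discreteTopology_of_isOpen_singleton_one ?_)
  have hg : 1 = g := h 1 (mem_of_mem_nhds hv)
  rw [isOpen_singleton_iff_nhds_eq_pure]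
  refine le_antisymm ?_ (pure_le_nhds _)
  rw [le_pure_iff]
  exact mem_of_superset hv fun x hx => (h x hx).trans hg.symm

variable [T2Space G]

/-- A sequence with small tail products, the partial products of which have no cluster point. -/
theorem exists_seq_small_tails_no_cluster [FirstCountableTopology G] [Countable G]
    (hG : ¬ DiscreteTopology G) :
    ∃ a : ℕ → G,
      (∀ O ∈ 𝓝 (1 : G), ∃ N, ∀ U : Finset ℕ, (∀ k ∈ U, N ≤ k) → ∏ k ∈ U, a k ∈ O) ∧
      ∀ g : G, ∃ O ∈ 𝓝 g, ∀ᶠ n in atTop, ∏ k ∈ Finset.range n, a k ∉ O := by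
  obtain ⟨u, hu⟩ := (𝓝 (1 : G)).exists_antitone_basis
  obtain ⟨g, hg⟩ := exists_surjective_nat G
  have step : ∀ (k : ℕ) (p : G) (v : {v : Set G // v ∈ 𝓝 (1 : G)}),
      ∃ a : G, ∃ w : {v : Set G // v ∈ 𝓝 (1 : G)}, a ∈ v.1 ∧ w.1 ⊆ u (k + 1) ∧ w.1 * w.1 ⊆ v.1 ∧
        ∃ O ∈ 𝓝 (g k), ∀ t ∈ w.1 * w.1, p * a * t ∉ O := by
    rintro k p ⟨v, hv⟩
    -- The new partial product `p * a` avoids the `k`-th element of `G`; `w` is then shrunk so that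
    -- all later partial products stay away from it.
    obtain ⟨a, hav, hag⟩ := exists_mem_ne_of_not_discrete hG hv (p⁻¹ * g k)
    have hne : p * a ≠ g k := fun h => hag (by rw [← h]; simp)
    obtain ⟨Q, O, hQ, hO, hdisj⟩ := t2_separation_nhds hne
    have hR : {x | p * a * x ∈ Q} ∈ 𝓝 (1 : G) := by
      have : ContinuousAt (fun x => p * a * x) 1 := by fun_prop
      exact this (by simpa using hQ)
    obtain ⟨w, hwo, hw1, hw⟩ := exists_open_nhds_one_mul_subset (inter_mem hR hv)
    refine ⟨a, ⟨w ∩ u (k + 1), inter_mem (hwo.mem_nhds hw1) (hu.1.mem_of_mem trivial)⟩, hav,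
      Set.inter_subset_right, ?_, O, hO, ?_⟩
    · exact (Set.mul_subset_mul Set.inter_subset_left Set.inter_subset_left).trans
        (hw.trans Set.inter_subset_right)
    · intro t ht htO
      have : t ∈ {x | p * a * x ∈ Q} :=
        (hw (Set.mul_subset_mul Set.inter_subset_left Set.inter_subset_left ht)).1
      exact Set.disjoint_left.1 hdisj this htO
  choose A w hA hwu hwv hO using step
  let s : ℕ → G × {v : Set G // v ∈ 𝓝 (1 : G)} := fun n =>
    Nat.rec (1, ⟨u 0, hu.1.mem_of_mem trivial⟩) (fun k x => (x.1 * A k x.1 x.2, w k x.1 x.2)) n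
  have hs : ∀ k, s (k + 1) = ((s k).1 * A k (s k).1 (s k).2, w k (s k).1 (s k).2) := fun _ => rfl
  set a : ℕ → G := fun k => A k (s k).1 (s k).2 with ha
  set v : ℕ → Set G := fun k => (s k).2.1 with hv
  have hp : ∀ n, ∏ k ∈ Finset.range n, a k = (s n).1 := by
    intro n
    induction n with
    | zero => rfl
    | succ n ih => rw [Finset.prod_range_succ, ih, hs]
  have h1 : ∀ k, 1 ∈ v k := fun k => mem_of_mem_nhds (s k).2.2
  have hvv : ∀ k, v (k + 1) * v (k + 1) ⊆ v k := fun k => hwv k _ _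
  have hav : ∀ k, a k ∈ v k := fun k => hA k _ _
  have hvu : ∀ k, v (k + 1) ⊆ u (k + 1) := fun k => hwu k _ _
  refine ⟨a, fun O hO => ?_, fun x => ?_⟩
  · obtain ⟨N, hN⟩ := hu.mem_iff.1 hO
    refine ⟨N + 2, fun U hU => ?_⟩
    exact hN (hu.2 (Nat.le_succ N) (hvu N (hvv (N + 1) (prod_mem_mul_self_of_tail h1 hvv hav hU))))
  · obtain ⟨k, rfl⟩ := hg x
    obtain ⟨O, hO, hOt⟩ := hO k (s k).1 (s k).2
    refine ⟨O, hO, eventually_atTop.2 ⟨k + 1, fun n hn => ?_⟩⟩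
    rw [← Finset.prod_range_mul_prod_Ico a hn, Finset.prod_range_succ, hp]
    refine hOt _ (prod_mem_mul_self_of_tail (v := v) (N := k + 1) h1 hvv hav fun i hi => ?_)
    exact (Finset.mem_Ico.1 hi).1

/-- For every `N` there is a block of indices beyond `N` over which the product of the sequence
stays outside of a given compact set, whatever quotients of products over other indices it is
multiplied with. -/
theorem exists_block_avoiding {a : ℕ → G}
    (ha : ∀ O ∈ 𝓝 (1 : G), ∃ N, ∀ U : Finset ℕ, (∀ k ∈ U, N ≤ k) → ∏ k ∈ U, a k ∈ O)
    (hcl : ∀ g : G, ∃ O ∈ 𝓝 g, ∀ᶠ n in atTop, ∏ k ∈ Finset.range n, a k ∉ O)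
    {C : Set G} (hC : IsCompact C) (N : ℕ) :
    ∃ N', N ≤ N' ∧ ∃ F ⊆ Finset.Ico N N', ∀ U V : Finset ℕ, U ∩ Finset.Ico N N' = F →
      V ∩ Finset.Ico N N' = ∅ → (∏ k ∈ U, a k) / ∏ k ∈ V, a k ∉ C := by
  -- The finite set `T` absorbs the influence of indices below `N`; indices beyond the block are
  -- harmless because `C * T` is closed and tails are small.
  set T : Set G := (fun p : Finset ℕ × Finset ℕ => (∏ k ∈ p.2, a k) / ∏ k ∈ p.1, a k) ''
    ((Finset.range N).powerset ×ˢ (Finset.range N).powerset : Finset _) with hT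
  have hTc : IsCompact T := ((Finset.finite_toSet _).image _).isCompact
  have hCT : IsCompact (C * T) := hC.mul hTc
  have hK : IsCompact (C * T * {∏ k ∈ Finset.range N, a k}) := hCT.mul isCompact_singleton
  obtain ⟨n, hNn, hn⟩ : ∃ n, N ≤ n ∧
      ∏ k ∈ Finset.range n, a k ∉ C * T * {∏ k ∈ Finset.range N, a k} := by
    by_contra! h
    obtain ⟨x, _, hx⟩ := hK.exists_mapClusterPt (f := atTop)
      (u := fun n => ∏ k ∈ Finset.range n, a k)
      (le_principal_iff.2 (mem_map.2 (mem_atTop_sets.2 ⟨N, h⟩)))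
    obtain ⟨O, hO, hev⟩ := hcl x
    exact (hx.frequently hO) hev
  set x := ∏ k ∈ Finset.Ico N n, a k with hx
  have hxCT : x ∉ C * T := by
    intro hmem
    refine hn ?_
    rw [← Finset.prod_range_mul_prod_Ico a hNn, mul_comm (∏ k ∈ Finset.range N, a k)]
    exact Set.mul_mem_mul hmem rfl
  have hnhds : {t : G | x * t ∈ (C * T)ᶜ} ∈ 𝓝 (1 : G) := by
    have hc : ContinuousAt (fun t => x * t) 1 := by fun_prop
    exact hc (by simpa using hCT.isClosed.isOpen_compl.mem_nhds hxCT)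
  obtain ⟨O, hO, hOd⟩ := exists_nhds_split_inv hnhds
  obtain ⟨N₁, hN₁⟩ := ha O hO
  have split : ∀ W : Finset ℕ, ∀ M, N ≤ M → ∏ k ∈ W, a k =
      (∏ k ∈ W with k < N, a k) * (∏ k ∈ W ∩ Finset.Ico N M, a k) * ∏ k ∈ W with M ≤ k, a k := by
    intro W M hM
    rw [← Finset.prod_filter_mul_prod_filter_not W (· < N),
      ← Finset.prod_filter_mul_prod_filter_not (W.filter (¬ · < N)) (· < M), mul_assoc]
    congr 2
    · refine Finset.prod_congr ?_ fun _ _ => rfl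
      ext k
      simp
      tauto
    · refine Finset.prod_congr ?_ fun _ _ => rfl
      ext k
      simp
      omega
  refine ⟨max n N₁, hNn.trans (le_max_left _ _), Finset.Ico N n,
    Finset.Ico_subset_Ico_right (le_max_left _ _), fun U V hU hV hmem => ?_⟩
  have htail : ∀ W : Finset ℕ, ∏ k ∈ W with max n N₁ ≤ k, a k ∈ O := fun W =>
    hN₁ _ fun k hk => (le_max_right _ _).trans (Finset.mem_filter.1 hk).2
  refine hOd _ (htail U) _ (htail V) ?_
  have hNM := hNn.trans (le_max_left n N₁)
  rw [split U _ hNM, split V _ hNM, hU, hV, Finset.prod_empty, mul_one] at hmem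
  refine ⟨_, hmem, (∏ k ∈ V with k < N, a k) / ∏ k ∈ U with k < N, a k,
    ⟨⟨U.filter (· < N), V.filter (· < N)⟩, ?_, rfl⟩, ?_⟩
  · simp only [Finset.coe_product, Set.mem_prod, Finset.mem_coe, Finset.mem_powerset]
    constructor <;>
    · intro k hk
      exact Finset.mem_range.2 (Finset.mem_filter.1 hk).2
  · simp only [← hx]
    generalize (∏ k ∈ U with k < N, a k) = p
    generalize (∏ k ∈ V with k < N, a k) = q
    generalize (∏ k ∈ U with max n N₁ ≤ k, a k) = r
    generalize (∏ k ∈ V with max n N₁ ≤ k, a k) = t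
    simp only [div_eq_mul_inv, mul_inv]
    have : p * x * r * (q⁻¹ * t⁻¹) * (q * p⁻¹) = (p * p⁻¹) * (q⁻¹ * q) * (x * (r * t⁻¹)) := by
      ac_rfl
    simp [this]

end Sequence

/-! ### Grid maps into the group and the dimension bound. -/

section Asdim

open Filter Topology

variable {G : Type*} [CommGroup G] [TopologicalSpace G] [IsTopologicalGroup G]

theorem exists_compact_forall_adjacent {a : ℕ → G} (ha : Tendsto a atTop (𝓝 1)) (d : ℕ) :
    ∃ A : Set G, IsCompact A ∧ ∀ F : Fin d → Finset ℕ, ∀ z z' : Fin d → ℕ,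
      (∀ i, z i ≤ z' i + 1 ∧ z' i ≤ z i + 1) →
        (∏ i, ∏ k ∈ F i with k < z i, a k) / ∏ i, ∏ k ∈ F i with k < z' i, a k ∈ A := by
  set A₁ : Set G := insert 1 (Set.range a) with hA₁
  have hc : IsCompact A₁ := ha.isCompact_insert_range
  have hpow : ∀ n : ℕ, IsCompact ((A₁ * A₁⁻¹) ^ n) := by
    intro n
    induction n with
    | zero => simp
    | succ n ih => rw [pow_succ]; exact ih.mul (hc.mul hc.inv)
  refine ⟨(A₁ * A₁⁻¹) ^ d, hpow d, fun F z z' h => ?_⟩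
  have hstep : ∀ (F : Finset ℕ) (m : ℕ), ∃ b ∈ A₁,
      ∏ k ∈ F with k < m + 1, a k = (∏ k ∈ F with k < m, a k) * b := by
    intro F m
    by_cases hm : m ∈ F
    · refine ⟨a m, Or.inr ⟨m, rfl⟩, ?_⟩
      have : F.filter (· < m + 1) = insert m (F.filter (· < m)) := by
        ext k
        simp only [Finset.mem_filter, Finset.mem_insert]
        constructor
        · rintro ⟨h1, h2⟩
          by_cases hk : k = m
          · exact Or.inl hk
          · exact Or.inr ⟨h1, by omega⟩
        · rintro (rfl | ⟨h1, h2⟩)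
          · exact ⟨hm, by omega⟩
          · exact ⟨h1, by omega⟩
      rw [this, Finset.prod_insert (by simp), mul_comm]
    · refine ⟨1, Or.inl rfl, ?_⟩
      rw [mul_one]
      refine Finset.prod_congr (Finset.filter_congr fun k hk => ?_) fun _ _ => rfl
      have : k ≠ m := fun e => hm (e ▸ hk)
      omega
  have h1 : (1 : G) ∈ A₁ := Or.inl rfl
  rw [← Finset.prod_div_distrib]
  have := Set.finsetProd_mem_finsetProd (Finset.univ : Finset (Fin d))
    (fun _ => A₁ * A₁⁻¹) (fun i => (∏ k ∈ F i with k < z i, a k) / ∏ k ∈ F i with k < z' i, a k) ?_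
  · simpa using this
  · intro i _
    obtain hi | hi | hi : z i = z' i ∨ z i = z' i + 1 ∨ z' i = z i + 1 := by
      have := h i
      omega
    · exact ⟨1, h1, 1, by simpa using h1, by simp [hi]⟩
    · obtain ⟨b, hb, e⟩ := hstep (F i) (z' i)
      exact ⟨b, hb, 1, by simpa using h1, by simp only [hi, e]; simp⟩
    · obtain ⟨b, hb, e⟩ := hstep (F i) (z i)
      exact ⟨1, h1, b⁻¹, by simpa using hb, by simp only [hi, e]; simp⟩

variable [T2Space G]

/-- Iterating `exists_block_avoiding` places the blocks in consecutive intervals. In the `i`-th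
interval the numerator uses the full block and the denominator nothing; the other coordinates only
affect indices outside it. -/
theorem exists_blocks_avoiding {a : ℕ → G}
    (ha : ∀ O ∈ 𝓝 (1 : G), ∃ N, ∀ U : Finset ℕ, (∀ k ∈ U, N ≤ k) → ∏ k ∈ U, a k ∈ O)
    (hcl : ∀ g : G, ∃ O ∈ 𝓝 g, ∀ᶠ n in atTop, ∏ k ∈ Finset.range n, a k ∉ O)
    {C : Set G} (hC : IsCompact C) (d : ℕ) :
    ∃ F : Fin d → Finset ℕ, ∀ i, ∀ z z' : Fin d → ℕ, (∀ k ∈ F i, k < z i) → z' i = 0 →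
        (∏ i, ∏ k ∈ F i with k < z i, a k) / ∏ i, ∏ k ∈ F i with k < z' i, a k ∉ C := by
  choose B hB F hF hFC using exists_block_avoiding ha hcl hC
  set N : ℕ → ℕ := fun n => B^[n] 0 with hN
  have hNs : ∀ n, N (n + 1) = B (N n) := fun n => Function.iterate_succ_apply' B n 0
  have hmono : Monotone N := monotone_nat_of_le_succ fun n => (hNs n).symm ▸ hB (N n)
  have hblock : ∀ {i k : ℕ}, k ∈ F (N i) → N i ≤ k ∧ k < N (i + 1) := by
    intro i k hk
    rw [hNs]
    exact Finset.mem_Ico.1 (hF _ hk)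
  have huniq : ∀ {i j k : ℕ}, k ∈ F (N i) → N j ≤ k → k < N (j + 1) → i = j := by
    intro i j k hi h1 h2
    have hi := hblock hi
    rcases lt_trichotomy i j with h | h | h
    · have := hmono (Nat.succ_le_of_lt h)
      simp only [Nat.succ_eq_add_one] at this
      omega
    · exact h
    · have := hmono (Nat.succ_le_of_lt h)
      simp only [Nat.succ_eq_add_one] at this
      omega
  set D : (Fin d → ℕ) → Finset ℕ := fun z =>
    Finset.univ.biUnion fun i : Fin d => (F (N i)).filter (· < z i) with hD
  have hprod : ∀ z : Fin d → ℕ,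
      ∏ i : Fin d, ∏ k ∈ F (N i) with k < z i, a k = ∏ k ∈ D z, a k := by
    intro z
    refine (Finset.prod_biUnion fun i _ j _ hij => ?_).symm
    refine Finset.disjoint_left.2 fun k hi hj => hij (Fin.ext ?_)
    have hj := hblock (Finset.mem_filter.1 hj).1
    exact huniq (Finset.mem_filter.1 hi).1 hj.1 hj.2
  have hinter : ∀ (z : Fin d → ℕ) (i : Fin d),
      D z ∩ Finset.Ico (N i) (B (N i)) = (F (N i)).filter (· < z i) := by
    intro z i
    ext k
    simp only [hD, Finset.mem_inter, Finset.mem_biUnion, Finset.mem_univ, true_and,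
      Finset.mem_filter, Finset.mem_Ico]
    constructor
    · rintro ⟨⟨j, hj, hjz⟩, h1, h2⟩
      obtain rfl : j = i := Fin.ext (huniq hj h1 (by rwa [hNs]))
      exact ⟨hj, hjz⟩
    · rintro ⟨hk, hkz⟩
      exact ⟨⟨i, hk, hkz⟩, Finset.mem_Ico.1 (hF _ hk)⟩
  refine ⟨fun i => F (N i), fun i z z' hz hz' => ?_⟩
  rw [hprod, hprod]
  refine hFC (N i) _ _ ?_ ?_
  · rw [hinter, Finset.filter_true_of_mem hz]
  · rw [hinter, hz']
    simp

theorem not_asdimLE_precompactIdeal [FirstCountableTopology G] [Countable G]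
    (hG : ¬ DiscreteTopology G) (n : ℕ) : ¬ (precompactIdeal G).coarseStructure.AsdimLE n := by
  intro hasdim
  obtain ⟨a, ha, hcl⟩ := exists_seq_small_tails_no_cluster hG
  have hlim : Tendsto a atTop (𝓝 1) := by
    intro O hO
    obtain ⟨N, hN⟩ := ha O hO
    exact mem_atTop_sets.2 ⟨N, fun k hk => by simpa using hN {k} (by simpa using hk)⟩
  obtain ⟨A, hA, hadj⟩ := exists_compact_forall_adjacent hlim (n + 1)
  obtain ⟨E, ⟨B, hB, hE⟩, M, hbdd, hcov, P, rfl, -, hdisj⟩ := hasdim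
    (GroupIdeal.basicEntourage A) ⟨A, hA.closure, subset_rfl⟩
  have hB' : IsCompact (closure B ∪ {1}) := hB.union isCompact_singleton
  -- Quotients of two points in one `E`-ball lie in this compact set.
  obtain ⟨F, hF⟩ := exists_blocks_avoiding ha hcl (hB'.inv.mul hB') (n + 1)
  set f : (Fin (n + 1) → ℕ) → G := fun z => ∏ i, ∏ k ∈ F i with k < z i, a k with hf
  have hmem : ∀ z, ∃ i, ∃ K ∈ P i, f z ∈ K := by
    intro z
    obtain ⟨K, hK, hz⟩ : f z ∈ ⋃₀ ⋃ i, P i := hcov ▸ Set.mem_univ _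
    obtain ⟨i, hi⟩ := Set.mem_iUnion.1 hK
    exact ⟨i, K, hi, hz⟩
  choose c K hKP hfK using hmem
  -- The last cell has coordinate `m - 1`, which must still exceed every index in the blocks; hence
  -- `+ 2`.
  set m := Finset.univ.sup (fun i => (F i).sup id) + 2 with hm
  obtain ⟨i, z, z', hz, hz', hKK, hz0, hzm⟩ := exists_cells_joining_faces (m := m) (by omega) c K
    (by
      intro z z' hzz hc
      by_contra hne
      have hempty := hdisj (c z) (K z) (hKP z) (K z') (hc ▸ hKP z') hne
      refine Set.eq_empty_iff_forall_notMem.1 hempty (f z') ⟨?_, hfK z'⟩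
      refine Set.mem_biUnion (hfK z) ?_
      refine GroupIdeal.mem_basicEntourage.2 (Or.inl ?_)
      rw [← div_eq_mul_inv]
      exact hadj F z z' hzz)
  obtain ⟨x, hx⟩ := hbdd (K z) (Set.mem_iUnion.2 ⟨_, hKP z⟩)
  have hball : ∀ y ∈ K z, x * y⁻¹ ∈ closure B ∪ {1} := fun y hy =>
    Set.union_subset_union_left _ subset_closure (GroupIdeal.mem_basicEntourage.1 (hE (hx hy)))
  refine hF i z' z (fun k hk => ?_) hz0 ?_
  · have h1 : k ≤ (F i).sup id := Finset.le_sup (f := id) hk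
    have h2 : (F i).sup id ≤ Finset.univ.sup (fun i => (F i).sup id) :=
      Finset.le_sup (f := fun i => (F i).sup id) (Finset.mem_univ i)
    omega
  · refine ⟨(x * (f z')⁻¹)⁻¹, Set.inv_mem_inv.2 (hball _ (hKK ▸ hfK z')), x * (f z)⁻¹,
      hball _ (hfK z), ?_⟩
    change (x * (f z')⁻¹)⁻¹ * (x * (f z)⁻¹) = f z' / f z
    simp [div_eq_mul_inv]

theorem asdim_precompactIdeal_eq_top [FirstCountableTopology G] [Countable G]
    (hG : ¬ DiscreteTopology G) : (precompactIdeal G).coarseStructure.asdim = ⊤ := by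
  rw [CoarseStructure.asdim, sInf_eq_top]
  rintro _ ⟨n, -, h⟩
  exact absurd h (not_asdimLE_precompactIdeal hG n)

/-- A discrete subgroup is closed, hence here compact and discrete, hence finite. -/
theorem not_discreteTopology_of_infinite_of_compactSpace [CompactSpace G] (S : Subgroup G)
    [Infinite S] : ¬ DiscreteTopology S := by
  intro h
  have hcl : IsClosed (S : Set G) := Subgroup.isClosed_of_discrete
  have : CompactSpace S := isCompact_iff_compactSpace.1 hcl.isCompact
  exact not_finite_iff_infinite.2 ‹Infinite S› finite_of_compact_of_discrete

end Asdim

theorem theorem3 :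
    (∀ (G : Type*) [CommGroup G] [TopologicalSpace G] [IsTopologicalGroup G]
        [TopologicalSpace.MetrizableSpace G] [Countable G],
        ¬ DiscreteTopology G → (precompactIdeal G).coarseStructure.asdim = ⊤) ∧
      (∀ S : Subgroup Circle, IsCyclic S → Infinite S →
        (precompactIdeal S).coarseStructure.asdim = ⊤) := by
  refine ⟨fun G _ _ _ _ _ hG => asdim_precompactIdeal_eq_top hG, fun S hS hinf => ?_⟩
  have : Countable S := by
    obtain ⟨g, hg⟩ := hS.exists_generator
    exact Function.Surjective.countable (f := fun n : ℤ => g ^ n) hg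
  exact asdim_precompactIdeal_eq_top (not_discreteTopology_of_infinite_of_compactSpace S)
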